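/- Let $M$ be an $n$-dimensional compact complex manifold, let $\mathcal L$ be a holomorphic line bundle over $M$, let $P,Q$ be two non-zero holomorphic sections of $\mathcal L$, and let $f=P/Q$ be the corresponding meromorphic function, i.e. the map $f:M\setminus\{P=Q=0\}\to\mathbb{CP}^1$, $f(x)=[P(x):Q(x)]$, with level sets $F_c=f^{-1}(c)\subset M\setminus\{P=Q=0\}$. A *generic fibre* of $f$ is a fibre $F_c$ with $c\notin A$, where $A\subset\mathbb{CP}^1$ is a finite set such that $f$ is a $C^\infty$ locally trivial fibration over $\mathbb{CP}^1\setminus A$; we then call $c$ a generic value of $f$. For $c\in\mathbb{CP}^1$ let $$\zeta_f^c(t)=\prod_{q\ge 0}\det\bigl[\mathrm{id}-t\,h_*|_{H_q(F;\mathbb C)}\bigr]^{(-1)^q}$$ be the zeta-function of the local monodromy of $f$ at $c$, where $h:F\to F$ is the monodromy transformation of a generic fibre $F$ along a sufficiently small simple loop around $c$. Let $\pi:\widetilde M\to M$ be an analytic map of an $n$-dimensional compact complex manifold $\widetilde M$ which is an isomorphism outside of the union of the indeterminacy set $\{P=Q=0\}$ and of finitely many level sets $f^{-1}(c_1),\dots,f^{-1}(c_s)$;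 that is, $\pi$ restricts to a biholomorphism from the preimage of the complement of this union onto that complement. Let $\widetilde f=(P\circ\pi)/(Q\circ\pi)$ be the lifting of $f$ to $\widetilde M$, the ratio of the lifted sections of $\pi^*\mathcal L$, with level sets $\widetilde F_c\subset\widetilde M\setminus\{P\circ\pi=Q\circ\pi=0\}$. Then the generic fibre of $\widetilde f$ coincides with that of $f$: for every $c\notin\{c_1,\dots,c_s\}$ the map $\pi$ restricts to a biholomorphism $\widetilde F_c\to F_c$, and $c$ is a generic value of $\widetilde f$ if and only if it is a generic value of $f$; moreover, every generic fibre of $\widetilde f$ is diffeomorphic to every generic fibre of $f$. Furthermore, for each $c\in\mathbb{CP}^1$, $$\zeta_{\widetilde f}^c(t)=\zeta_f^c(t).$$ -/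

import Mathlib

open Bundle Filter Set Topology TopologicalSpace
open scoped Manifold ContDiff

universe u v

noncomputable section

/-! ### The complex projective line as a complex manifold -/

namespace ProjLine

/-- The involution `z ↦ 1 / z` of the projective line `ℂ ∪ {∞}`. -/
def inversion (c : OnePoint ℂ) : OnePoint ℂ :=
  open Classical in c.elim ((0 : ℂ) : OnePoint ℂ) fun z => if z = 0 then OnePoint.infty else ((z⁻¹ : ℂ) : OnePoint ℂ)

theorem inversion_infty : inversion OnePoint.infty = ((0 : ℂ) : OnePoint ℂ) := rfl

theorem inversion_zero : inversion ((0 : ℂ) : OnePoint ℂ) = OnePoint.infty := if_pos rfl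

theorem inversion_coe {z : ℂ} (hz : z ≠ 0) :
    inversion (z : OnePoint ℂ) = ((z⁻¹ : ℂ) : OnePoint ℂ) := if_neg hz

theorem inversion_inversion (c : OnePoint ℂ) : inversion (inversion c) = c := by
  induction c using OnePoint.rec with
  | infty => rw [inversion_infty, inversion_zero]
  | coe z =>
    by_cases hz : z = 0
    · rw [hz, inversion_zero, inversion_infty]
    · rw [inversion_coe hz, inversion_coe (inv_ne_zero hz), inv_inv]

theorem continuous_inversion : Continuous inversion := by
  rw [continuous_iff_continuousAt]
  intro c
  induction c using OnePoint.rec with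
  | infty =>
    rw [OnePoint.continuousAt_infty', inversion_infty, Filter.coclosedCompact_eq_cocompact,
      ← Metric.cobounded_eq_cocompact]
    have h : Tendsto (fun z : ℂ => ((z⁻¹ : ℂ) : OnePoint ℂ)) (Bornology.cobounded ℂ)
        (𝓝 ((0 : ℂ) : OnePoint ℂ)) :=
      (OnePoint.continuous_coe.tendsto (0 : ℂ)).comp tendsto_inv₀_cobounded
    refine h.congr' ?_
    have h0 : ∀ᶠ z : ℂ in Bornology.cobounded ℂ, z ≠ 0 := by
      have := (Metric.cobounded_eq_cocompact (α := ℂ)) ▸ (isCompact_singleton (x := (0 : ℂ))).compl_mem_cocompact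
      exact this
    filter_upwards [h0] with z hz
    exact (inversion_coe hz).symm
  | coe z =>
    rw [OnePoint.continuousAt_coe]
    by_cases hz : z = 0
    · subst hz
      rw [continuousAt_iff_punctured_nhds]
      have h : Tendsto (fun z : ℂ => ((z⁻¹ : ℂ) : OnePoint ℂ)) (𝓝[≠] 0) (𝓝 OnePoint.infty) := by
        refine OnePoint.tendsto_coe_infty.comp ?_
        rw [Filter.coclosedCompact_eq_cocompact, ← Metric.cobounded_eq_cocompact]
        exact tendsto_inv₀_nhdsNE_zero
      simp only [Function.comp_apply, inversion_zero]
      refine h.congr' ?_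
      filter_upwards [self_mem_nhdsWithin] with w hw
      exact (inversion_coe hw).symm
    · have h : ContinuousAt (fun z : ℂ => ((z⁻¹ : ℂ) : OnePoint ℂ)) z :=
        OnePoint.continuous_coe.continuousAt.comp (continuousAt_inv₀ hz)
      refine h.congr ?_
      filter_upwards [isOpen_ne.mem_nhds hz] with w hw
      exact (inversion_coe hw).symm

/-- The inversion as a homeomorphism. -/
def inversionHomeo : OnePoint ℂ ≃ₜ OnePoint ℂ where
  toFun := inversion
  invFun := inversion
  left_inv := inversion_inversion
  right_inv := inversion_inversion
  continuous_toFun := continuous_inversion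
  continuous_invFun := continuous_inversion

/-- The affine coordinate `z` on the complement of `∞`. -/
def affineChart : OpenPartialHomeomorph (OnePoint ℂ) ℂ :=
  (OnePoint.isOpenEmbedding_coe.toOpenPartialHomeomorph ((↑) : ℂ → OnePoint ℂ)).symm

/-- The coordinate `1 / z` on the complement of `0`. -/
def inftyChart : OpenPartialHomeomorph (OnePoint ℂ) ℂ :=
  inversionHomeo.toOpenPartialHomeomorph.trans affineChart

/-- The projective line with its two standard charts. -/
instance chartedSpace : ChartedSpace ℂ (OnePoint ℂ) where
  atlas := {affineChart, inftyChart}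
  chartAt c := open Classical in if c = OnePoint.infty then inftyChart else affineChart
  mem_chart_source c := by
    induction c using OnePoint.rec with
    | infty =>
      simp [inftyChart, affineChart, inversionHomeo, inversion_infty]
    | coe z => simp [affineChart, OnePoint.coe_ne_infty]
  chart_mem_atlas c := by
    by_cases h : c = OnePoint.infty <;> simp [h]

theorem affineChart_symm_apply (z : ℂ) : affineChart.symm z = (z : OnePoint ℂ) := rfl

theorem affineChart_coe (z : ℂ) : affineChart (z : OnePoint ℂ) = z :=
  OpenPartialHomeomorph.left_inv
    (OnePoint.isOpenEmbedding_coe.toOpenPartialHomeomorph ((↑) : ℂ → OnePoint ℂ)) (by simp)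

theorem inftyChart_coe {z : ℂ} (hz : z ≠ 0) : inftyChart (z : OnePoint ℂ) = z⁻¹ := by
  change affineChart (inversion (z : OnePoint ℂ)) = z⁻¹
  rw [inversion_coe hz, affineChart_coe]

instance isManifold : IsManifold 𝓘(ℂ, ℂ) ω (OnePoint ℂ) := by
  have hsrc : ∀ c : OnePoint ℂ, c ∈ affineChart.source ↔ c ≠ OnePoint.infty := by
    intro c
    induction c using OnePoint.rec <;> simp [affineChart]
  have hsrc' : ∀ c : OnePoint ℂ, c ∈ inftyChart.source ↔ inversion c ≠ OnePoint.infty := by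
    intro c
    rw [← hsrc]
    simp [inftyChart, inversionHomeo]
  have hinv : ∀ s : Set ℂ, (∀ z ∈ s, z ≠ 0) → ContDiffOn ℂ ω (fun z : ℂ => z⁻¹) s :=
    fun s hs z hz => (contDiffAt_inv ℂ (hs z hz)).contDiffWithinAt
  apply isManifold_of_contDiffOn
  have hmem : ∀ z : ℂ, inversion (z : OnePoint ℂ) ≠ OnePoint.infty → z ≠ 0 := by
    rintro z hz rfl
    exact hz inversion_zero
  rintro e e' (rfl | rfl) (rfl | rfl)
  · refine contDiffOn_id.congr fun z _ => ?_
    exact affineChart_coe z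
  · have key : ∀ z ∈ 𝓘(ℂ, ℂ).symm ⁻¹' (affineChart.symm.trans inftyChart).source ∩
        range 𝓘(ℂ, ℂ), z ≠ 0 := by
      rintro z ⟨hz, -⟩
      exact hmem z ((hsrc' _).1 hz.2)
    exact (hinv _ key).congr fun z hz => inftyChart_coe (key z hz)
  · have key : ∀ z ∈ 𝓘(ℂ, ℂ).symm ⁻¹' (inftyChart.symm.trans affineChart).source ∩
        range 𝓘(ℂ, ℂ), z ≠ 0 := by
      rintro z ⟨hz, -⟩
      exact hmem z ((hsrc _).1 hz.2)
    refine (hinv _ key).congr fun z hz => ?_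
    change affineChart (inversion (z : OnePoint ℂ)) = z⁻¹
    rw [inversion_coe (key z hz), affineChart_coe]
  · refine contDiffOn_id.congr fun z _ => ?_
    change affineChart (inversion (inversion (z : OnePoint ℂ))) = z
    rw [inversion_inversion, affineChart_coe]

end ProjLine


/-! ### Ratios of sections of a line bundle -/

/-- The point `[p : q]` of the projective line determined by two vectors `p`, `q` of a complex
line, not both zero: the number `z` with `p = z • q` if `q ≠ 0`, and `∞` if `q = 0`.
(The value is irrelevant when `p = q = 0`.) -/
def lineRatio {V : Type*} [AddCommMonoid V] [Module ℂ V] (p q : V) : OnePoint ℂ :=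
  open Classical in
  if h : ∃ z : ℂ, p = z • q then ((Classical.choose h : ℂ) : OnePoint ℂ) else OnePoint.infty

theorem lineRatio_eq_coe {V : Type*} [AddCommGroup V] [Module ℂ V] {p q : V} {z : ℂ}
    (hq : q ≠ 0) (h : p = z • q) : lineRatio p q = (z : OnePoint ℂ) := by
  have h' : ∃ z : ℂ, p = z • q := ⟨z, h⟩
  rw [lineRatio, dif_pos h']
  congr 1
  exact smul_left_injective ℂ hq ((Classical.choose_spec h').symm.trans h)

theorem lineRatio_eq_infty {V : Type*} [AddCommGroup V] [Module ℂ V] {p q : V}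
    (hp : p ≠ 0) (hq : q = 0) : lineRatio p q = OnePoint.infty := by
  rw [lineRatio, dif_neg]
  rintro ⟨z, hz⟩
  exact hp (by rw [hz, hq, smul_zero])

theorem lineRatio_map {V W : Type*} [AddCommMonoid V] [Module ℂ V] [AddCommMonoid W] [Module ℂ W]
    (e : V ≃ₗ[ℂ] W) (p q : V) : lineRatio (e p) (e q) = lineRatio p q := by
  have : (fun z : ℂ => e p = z • e q) = fun z : ℂ => p = z • q := by
    funext z
    rw [← map_smul, e.injective.eq_iff]
  classical
  have gen : ∀ s t : ℂ → Prop, s = t →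
      (if h : ∃ z, s z then ((Classical.choose h : ℂ) : OnePoint ℂ) else OnePoint.infty) =
        if h : ∃ z, t z then ((Classical.choose h : ℂ) : OnePoint ℂ) else OnePoint.infty := by
    rintro s _ rfl
    rfl
  unfold lineRatio
  convert gen _ _ this

theorem continuousAt_lineRatio {x : ℂ × ℂ} (hx : x.1 ≠ 0 ∨ x.2 ≠ 0) :
    ContinuousAt (fun y : ℂ × ℂ => lineRatio y.1 y.2) x := by
  by_cases h2 : x.2 = 0
  · have h1 : x.1 ≠ 0 := hx.resolve_right (not_not.2 h2)
    have hc : ContinuousAt (fun y : ℂ × ℂ =>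
        ProjLine.inversion ((y.2 / y.1 : ℂ) : OnePoint ℂ)) x :=
      ProjLine.continuous_inversion.continuousAt.comp
        (OnePoint.continuous_coe.continuousAt.comp (continuousAt_snd.div continuousAt_fst h1))
    refine hc.congr ?_
    filter_upwards [continuousAt_fst.eventually_ne h1] with y hy
    by_cases hy2 : y.2 = 0
    · rw [lineRatio_eq_infty hy hy2, hy2, zero_div, ProjLine.inversion_zero]
    · rw [ProjLine.inversion_coe (div_ne_zero hy2 hy), inv_div]
      refine (lineRatio_eq_coe hy2 ?_).symm
      rw [smul_eq_mul, div_mul_cancel₀ _ hy2]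
  · have hc : ContinuousAt (fun y : ℂ × ℂ => ((y.1 / y.2 : ℂ) : OnePoint ℂ)) x :=
      OnePoint.continuous_coe.continuousAt.comp (continuousAt_fst.div continuousAt_snd h2)
    refine hc.congr ?_
    filter_upwards [continuousAt_snd.eventually_ne h2] with y hy
    refine (lineRatio_eq_coe hy ?_).symm
    rw [smul_eq_mul, div_mul_cancel₀ _ hy]

/-- The model space of complex manifolds of dimension `n`. -/
abbrev Cn (n : ℕ) := EuclideanSpace ℂ (Fin n)

namespace MeroFun

section

variable {n : ℕ} {M : Type u} [TopologicalSpace M] [ChartedSpace (Cn n) M]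
  {L : M → Type v} [∀ x, AddCommMonoid (L x)] [∀ x, Module ℂ (L x)]
  [∀ x, TopologicalSpace (L x)] [TopologicalSpace (TotalSpace ℂ L)] [FiberBundle ℂ L]
  [VectorBundle ℂ ℂ L]

/-- The value `f x = [P x : Q x]` of `f = P / Q` at a point `x` outside of the indeterminacy set. -/
def toProj (P Q : Cₛ^ω⟮𝓘(ℂ, Cn n); ℂ, L⟯) (x : M) : OnePoint ℂ := lineRatio (P x) (Q x)

/-- The indeterminacy set `{P = Q = 0}` of `f = P / Q`. -/
def indeterminacy (P Q : Cₛ^ω⟮𝓘(ℂ, Cn n); ℂ, L⟯) : Set M := {x | P x = 0 ∧ Q x = 0}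

/-- The level set `F_c = f⁻¹(c)` of the map `f : M ∖ {P = Q = 0} → ℂℙ¹`. -/
def fibre (P Q : Cₛ^ω⟮𝓘(ℂ, Cn n); ℂ, L⟯) (c : OnePoint ℂ) : Set M :=
  {x | x ∉ indeterminacy P Q ∧ toProj P Q x = c}

theorem isOpen_preimage (P Q : Cₛ^ω⟮𝓘(ℂ, Cn n); ℂ, L⟯) {U : Set (OnePoint ℂ)} (hU : IsOpen U) :
    IsOpen {x | x ∉ indeterminacy P Q ∧ toProj P Q x ∈ U} := by
  rw [isOpen_iff_mem_nhds]
  rintro x₀ ⟨h₀, hU₀⟩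
  set e := trivializationAt ℂ L x₀ with he
  have hx₀ : x₀ ∈ e.baseSet := mem_baseSet_trivializationAt ℂ L x₀
  have hsec : ∀ R : Cₛ^ω⟮𝓘(ℂ, Cn n); ℂ, L⟯,
      ContinuousAt (fun x => (e ⟨x, R x⟩).2) x₀ := by
    intro R
    have h1 : ContinuousAt e (⟨x₀, R x₀⟩ : TotalSpace ℂ L) :=
      e.continuousAt (e.mem_source.2 hx₀)
    exact continuousAt_snd.comp
      (ContinuousAt.comp (f := fun x => (⟨x, R x⟩ : TotalSpace ℂ L)) h1
        R.contMDiff.continuous.continuousAt)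
  have hlin : ∀ x (hx : x ∈ e.baseSet) (v : L x), (e.continuousLinearEquivAt ℂ x hx) v =
      (e ⟨x, v⟩).2 := fun x hx v => rfl
  have hzero : ∀ x, x ∈ e.baseSet → ∀ v : L x, (e ⟨x, v⟩).2 = 0 ↔ v = 0 := by
    intro x hx v
    rw [← hlin x hx]
    exact (e.continuousLinearEquivAt ℂ x hx).map_eq_zero_iff
  have hrat : ∀ x, x ∈ e.baseSet → lineRatio (e ⟨x, P x⟩).2 (e ⟨x, Q x⟩).2 = toProj P Q x :=
    fun x hx => lineRatio_map (e.continuousLinearEquivAt ℂ x hx).toLinearEquiv (P x) (Q x)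
  have hpair : ContinuousAt (fun x => ((e ⟨x, P x⟩).2, (e ⟨x, Q x⟩).2)) x₀ :=
    (hsec P).prodMk (hsec Q)
  have hne : (e ⟨x₀, P x₀⟩).2 ≠ 0 ∨ (e ⟨x₀, Q x₀⟩).2 ≠ 0 := by
    rw [Ne, Ne, hzero x₀ hx₀, hzero x₀ hx₀]
    exact not_and_or.1 h₀
  have hcont : ContinuousAt (fun x => lineRatio (e ⟨x, P x⟩).2 (e ⟨x, Q x⟩).2) x₀ :=
    ContinuousAt.comp (f := fun x => ((e ⟨x, P x⟩).2, (e ⟨x, Q x⟩).2))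
      (g := fun y : ℂ × ℂ => lineRatio y.1 y.2) (continuousAt_lineRatio hne) hpair
  have hmem := hcont.preimage_mem_nhds (hU.mem_nhds ((hrat x₀ hx₀).symm ▸ hU₀))
  have hne' : ∀ᶠ x in 𝓝 x₀, ((e ⟨x, P x⟩).2, (e ⟨x, Q x⟩).2) ≠ (0, 0) :=
    hpair.eventually_ne (by rw [Ne, Prod.mk.injEq, not_and_or]; exact hne)
  filter_upwards [hmem, hne', e.open_baseSet.mem_nhds hx₀] with x hx1 hx2 hx3
  refine ⟨fun h => hx2 ?_, ?_⟩
  · rw [Prod.mk.injEq, hzero x hx3, hzero x hx3]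
    exact h
  · rw [← hrat x hx3]
    exact hx1

/-- The preimage `f⁻¹(U)` of an open set, as an open submanifold of `M`. -/
def preimage (P Q : Cₛ^ω⟮𝓘(ℂ, Cn n); ℂ, L⟯) (U : Opens (OnePoint ℂ)) : Opens M :=
  ⟨{x | x ∉ indeterminacy P Q ∧ toProj P Q x ∈ U}, isOpen_preimage P Q U.2⟩

/-- `f` is a `C^∞` trivial fibration over `U`: there are a `C^∞` manifold `F`, of real dimension
`2 n - 2`, and a `C^∞` diffeomorphism `f⁻¹(U) ≃ U × F` over `U`. -/
def IsTrivialOver (P Q : Cₛ^ω⟮𝓘(ℂ, Cn n); ℂ, L⟯) (U : Opens (OnePoint ℂ)) : Prop :=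
  ∃ (F : Type u) (_ : TopologicalSpace F)
    (_ : ChartedSpace (EuclideanSpace ℝ (Fin (2 * n - 2))) F)
    (_ : IsManifold 𝓘(ℝ, EuclideanSpace ℝ (Fin (2 * n - 2))) ∞ F)
    (e : Diffeomorph 𝓘(ℝ, Cn n)
      (𝓘(ℝ, ℂ).prod 𝓘(ℝ, EuclideanSpace ℝ (Fin (2 * n - 2)))) (preimage P Q U) (U × F) ∞),
    ∀ x, ((e x).1 : OnePoint ℂ) = toProj P Q x

/-- `f` is a `C^∞` locally trivial fibration over the subset `V` of the projective line. -/
def IsLocallyTrivialOver (P Q : Cₛ^ω⟮𝓘(ℂ, Cn n); ℂ, L⟯) (V : Set (OnePoint ℂ)) : Prop :=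
  ∀ c ∈ V, ∃ U : Opens (OnePoint ℂ), c ∈ U ∧ IsTrivialOver P Q U

/-- `F_c` is a generic fibre of `f`: it is a fibre of the `C^∞` locally trivial fibration that `f`
defines over the complement of a finite set `A`. -/
def IsGenericValue (P Q : Cₛ^ω⟮𝓘(ℂ, Cn n); ℂ, L⟯) (c : OnePoint ℂ) : Prop :=
  ∃ A : Set (OnePoint ℂ), A.Finite ∧ IsLocallyTrivialOver P Q Aᶜ ∧ c ∉ A

end

end MeroFun

/-! ### Zeta-functions of maps -/

/-- The singular homology `H_q(X; ℂ)`. -/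
abbrev complexHomology (q : ℕ) (X : Type u) [TopologicalSpace X] : ModuleCat.{u} ℂ :=
  ((AlgebraicTopology.singularHomologyFunctor (ModuleCat.{u} ℂ) q).obj
    (ModuleCat.of ℂ (ULift.{u} ℂ))).obj (TopCat.of X)

/-- The action `h_*` of a continuous map `h : X → X` on `H_q(X; ℂ)`. -/
def homologyAction (q : ℕ) {X : Type u} [TopologicalSpace X] (h : C(X, X)) :
    complexHomology q X →ₗ[ℂ] complexHomology q X :=
  (((AlgebraicTopology.singularHomologyFunctor (ModuleCat.{u} ℂ) q).obj
    (ModuleCat.of ℂ (ULift.{u} ℂ))).map (TopCat.ofHom h)).hom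

/-- The total homology `H_*(X; ℂ)` is finite-dimensional. -/
def HasFiniteHomology (X : Type u) [TopologicalSpace X] : Prop :=
  (∀ q, FiniteDimensional ℂ (complexHomology q X)) ∧
    ∀ᶠ q in atTop, Subsingleton (complexHomology q X)

/-- The zeta-function `ζ_h(t) = ∏_{q ≥ 0} det [id - t h_* | H_q(X; ℂ)] ^ ((-1) ^ q)` of a
self-map of a space with finite-dimensional total homology. -/
def zetaFunction {X : Type u} [TopologicalSpace X] (h : C(X, X)) : RatFunc ℂ :=
  ∏ᶠ q : ℕ, (LinearMap.det (LinearMap.id -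
    (RatFunc.X : RatFunc ℂ) • (homologyAction q h).baseChange (RatFunc ℂ))) ^ ((-1 : ℤ) ^ q)

/-! ### Local monodromy -/

/-- The simple loop around `c` which is, in the coordinate `z - c` if `c ≠ ∞` and in the
coordinate `1 / z` if `c = ∞`, the counterclockwise circle of radius `r` around the origin. -/
def simpleLoop (c : OnePoint ℂ) (r : ℝ) (t : unitInterval) : OnePoint ℂ :=
  c.elim (((circleMap 0 r (2 * Real.pi * t))⁻¹ : ℂ) : OnePoint ℂ)
    fun z => ((circleMap z r (2 * Real.pi * t) : ℂ) : OnePoint ℂ)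

namespace MeroFun

section

variable {n : ℕ} {M : Type u} [TopologicalSpace M] [ChartedSpace (Cn n) M]
  {L : M → Type v} [∀ x, AddCommMonoid (L x)] [∀ x, Module ℂ (L x)]
  [∀ x, TopologicalSpace (L x)] [TopologicalSpace (TotalSpace ℂ L)] [FiberBundle ℂ L]
  [VectorBundle ℂ ℂ L]

/-- `h : F_{γ(0)} → F_{γ(0)}` is a monodromy transformation of `f` along the loop `γ`: there is a
continuous family of maps `Γ_t : F_{γ(0)} → F_{γ(t)}` with `Γ_0 = id` and `Γ_1 = h`. -/
def IsMonodromy (P Q : Cₛ^ω⟮𝓘(ℂ, Cn n); ℂ, L⟯) (γ : unitInterval → OnePoint ℂ)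
    (h : C(fibre P Q (γ 0), fibre P Q (γ 0))) : Prop :=
  ∃ Γ : unitInterval × fibre P Q (γ 0) → M, Continuous Γ ∧
    (∀ t x, Γ (t, x) ∈ fibre P Q (γ t)) ∧ (∀ x, Γ (0, x) = x) ∧ ∀ x, Γ (1, x) = h x

/-- `ζ` is the zeta-function of the local monodromy of `f` corresponding to the value `c`: all
sufficiently small simple loops around `c` run inside the set of generic values, they have a
monodromy transformation, the fibre has finite-dimensional homology, and every monodromy
transformation along such a loop has the zeta-function `ζ`. -/
def HasLocalZeta (P Q : Cₛ^ω⟮𝓘(ℂ, Cn n); ℂ, L⟯) (c : OnePoint ℂ) (ζ : RatFunc ℂ) : Prop :=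
  ∀ᶠ r : ℝ in 𝓝[>] 0,
    (∀ t, IsGenericValue P Q (simpleLoop c r t)) ∧
    HasFiniteHomology (fibre P Q (simpleLoop c r 0)) ∧
    (∃ h, IsMonodromy P Q (simpleLoop c r) h) ∧
    ∀ h, IsMonodromy P Q (simpleLoop c r) h → zetaFunction h = ζ

theorem HasLocalZeta.unique {P Q : Cₛ^ω⟮𝓘(ℂ, Cn n); ℂ, L⟯} {c : OnePoint ℂ} {ζ ζ' : RatFunc ℂ}
    (h : HasLocalZeta P Q c ζ) (h' : HasLocalZeta P Q c ζ') : ζ = ζ' := by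
  obtain ⟨r, ⟨-, -, ⟨g, hg⟩, h1⟩, -, -, -, h2⟩ := (h.and h').exists
  exact (h1 g hg).symm.trans (h2 g hg)

/-- The zeta-function `ζ_f^c` of the local monodromy of `f` corresponding to the value `c`. -/
def localZeta (P Q : Cₛ^ω⟮𝓘(ℂ, Cn n); ℂ, L⟯) (c : OnePoint ℂ) : RatFunc ℂ :=
  open Classical in if h : ∃ ζ, HasLocalZeta P Q c ζ then Classical.choose h else 0

end

/-! ### Modifications and liftings -/

section

variable {n : ℕ} {M : Type u} [TopologicalSpace M] [ChartedSpace (Cn n) M]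
  {M' : Type u} [TopologicalSpace M'] [ChartedSpace (Cn n) M']
  {L : M → Type v} [∀ x, AddCommMonoid (L x)] [∀ x, Module ℂ (L x)]
  [∀ x, TopologicalSpace (L x)] [TopologicalSpace (TotalSpace ℂ L)] [FiberBundle ℂ L]
  [VectorBundle ℂ ℂ L]

/-- The lifting `P ∘ φ` of a section `P` of `L`, a section of the pulled back line bundle. -/
def liftSection (φ : C^ω⟮𝓘(ℂ, Cn n), M'; 𝓘(ℂ, Cn n), M⟯) (P : Cₛ^ω⟮𝓘(ℂ, Cn n); ℂ, L⟯) :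
    Cₛ^ω⟮𝓘(ℂ, Cn n); ℂ, (φ : M' → M) *ᵖ L⟯ where
  toFun x := P (φ x)
  contMDiff_toFun x₀ := by
    have h := (Bundle.contMDiffAt_section (E := L) (n := ω) (IB := 𝓘(ℂ, Cn n)) (φ x₀)).1
      (P.contMDiff (φ x₀))
    exact (Bundle.contMDiffAt_section (E := (φ : M' → M) *ᵖ L) (n := ω) (IB := 𝓘(ℂ, Cn n)) x₀).2
      (h.comp x₀ (φ.contMDiff x₀) :)

/-- The analytic map `φ` is an isomorphism over `V ⊆ M`: its restriction `φ⁻¹(V) → V` is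
bijective and locally biholomorphic. -/
def IsIsoOver (φ : C^ω⟮𝓘(ℂ, Cn n), M'; 𝓘(ℂ, Cn n), M⟯) (V : Set M) : Prop :=
  BijOn φ (φ ⁻¹' V) V ∧ IsLocalDiffeomorphOn 𝓘(ℂ, Cn n) 𝓘(ℂ, Cn n) ω φ (φ ⁻¹' V)

end

end MeroFun

/-- A `C^k` map `g : A → N` on a subset `A` of a manifold `M`: locally on `M`, it extends to a
`C^k` map from an open subset of `M` to `N`. -/
def IsCkOnSubset {𝕜 : Type*} [NontriviallyNormedField 𝕜] {E H E' H' : Type*}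
    [NormedAddCommGroup E] [NormedSpace 𝕜 E] [TopologicalSpace H]
    [NormedAddCommGroup E'] [NormedSpace 𝕜 E'] [TopologicalSpace H']
    (I : ModelWithCorners 𝕜 E H) (J : ModelWithCorners 𝕜 E' H') (k : ℕ∞ω)
    {M N : Type*} [TopologicalSpace M] [ChartedSpace H M] [TopologicalSpace N]
    [ChartedSpace H' N] (A : Set M) (g : A → N) : Prop :=
  ∀ a : A, ∃ (W : Set M) (G : M → N), IsOpen W ∧ (a : M) ∈ W ∧ ContMDiffOn I J k G W ∧
    ∀ b : A, (b : M) ∈ W → G b = g b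

/-- A `C^k` diffeomorphism between a subset `A` of a manifold `M` and a subset `B` of a manifold
`N`. For `k = ω` over `ℂ` this is a biholomorphism. -/
structure SubsetDiffeo {𝕜 : Type*} [NontriviallyNormedField 𝕜] {E H E' H' : Type*}
    [NormedAddCommGroup E] [NormedSpace 𝕜 E] [TopologicalSpace H]
    [NormedAddCommGroup E'] [NormedSpace 𝕜 E'] [TopologicalSpace H']
    (I : ModelWithCorners 𝕜 E H) (J : ModelWithCorners 𝕜 E' H') (k : ℕ∞ω)
    {M N : Type*} [TopologicalSpace M] [ChartedSpace H M] [TopologicalSpace N]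
    [ChartedSpace H' N] (A : Set M) (B : Set N) extends A ≃ B where
  isCk_toFun : IsCkOnSubset I J k A fun a => (toEquiv a : N)
  isCk_invFun : IsCkOnSubset J I k B fun b => (toEquiv.symm b : M)

end

/-! Let `W` be the complement of the finite set `S` of exceptional values. The set over which `φ` is
assumed to be an isomorphism is exactly the preimage of `W` under `f`. So `φ` restricts to a
biholomorphism `d` between the preimages of `W` under the two functions
(`IsIsoOver.exists_diffeomorph`), and `d` commutes with the maps to the projective line, because the
lifted ratio at `x` is the ratio at `φ x`.

Everything asserted depends only on what happens over `W`. Fibres outside `S` correspond under `d`.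
Genericity allows an arbitrary finite exceptional set, so `S` may be added to it. Small loops around
any value avoid `S`, even when their centre lies in `S`, so `d` conjugates the monodromy
transformations along them; conjugate maps have the same zeta-function because homology is
functorial and determinants are conjugation invariant (`zetaFunction_conj`).

Generic values of the two functions may lie in `S`, where `d` gives nothing. For these, local
triviality and connectedness of the projective line minus a finite set
(`IsLocallyTrivialOver.nonempty_subsetDiffeo`) allow moving to a common value outside `S`. -/

noncomputable section

/-! ### Invariance of the zeta-function under conjugation -/

/-- The isomorphism of homology groups induced by a homeomorphism. -/
def homologyEquiv (q : ℕ) {X Y : Type u} [TopologicalSpace X] [TopologicalSpace Y] (a : X ≃ₜ Y) :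
    complexHomology q X ≃ₗ[ℂ] complexHomology q Y :=
  (((AlgebraicTopology.singularHomologyFunctor (ModuleCat.{u} ℂ) q).obj
    (ModuleCat.of ℂ (ULift.{u} ℂ))).mapIso
      (TopCat.isoOfHomeo (X := TopCat.of X) (Y := TopCat.of Y) a)).toLinearEquiv

/-- The hypothesis says `k = a ∘ h ∘ a⁻¹`; apply the homology functor. -/
theorem homologyAction_conj (q : ℕ) {X Y : Type u} [TopologicalSpace X] [TopologicalSpace Y]
    (a : X ≃ₜ Y) {h : C(X, X)} {k : C(Y, Y)} (hk : ∀ x, k (a x) = a (h x)) :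
    homologyAction q k = (homologyEquiv q a : complexHomology q X →ₗ[ℂ] complexHomology q Y) ∘ₗ
      homologyAction q h ∘ₗ
        ((homologyEquiv q a).symm : complexHomology q Y →ₗ[ℂ] complexHomology q X) := by
  have h1 : TopCat.ofHom k = CategoryTheory.CategoryStruct.comp
      (TopCat.isoOfHomeo (X := TopCat.of X) (Y := TopCat.of Y) a).inv
      (CategoryTheory.CategoryStruct.comp (TopCat.ofHom h)
        (TopCat.isoOfHomeo (X := TopCat.of X) (Y := TopCat.of Y) a).hom) := by
    ext y
    obtain ⟨x, rfl⟩ := a.surjective y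
    change k (a x) = a (h (a.symm (a x)))
    rw [hk, a.symm_apply_apply]
  rw [homologyAction, h1, CategoryTheory.Functor.map_comp, CategoryTheory.Functor.map_comp]
  rfl

theorem HasFiniteHomology.of_homeomorph {X Y : Type u} [TopologicalSpace X] [TopologicalSpace Y]
    (a : X ≃ₜ Y) (h : HasFiniteHomology X) : HasFiniteHomology Y := by
  refine ⟨fun q => ?_, h.2.mono fun q hq => (homologyEquiv q a).symm.toEquiv.subsingleton⟩
  have := h.1 q
  exact (homologyEquiv q a).finiteDimensional

/-- Each factor is unchanged: the conjugating isomorphism on homology survives base change to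
`RatFunc ℂ`, and a determinant is invariant under conjugation. -/
theorem zetaFunction_conj {X Y : Type u} [TopologicalSpace X] [TopologicalSpace Y]
    (a : X ≃ₜ Y) {h : C(X, X)} {k : C(Y, Y)} (hk : ∀ x, k (a x) = a (h x)) :
    zetaFunction k = zetaFunction h := by
  refine finprod_congr fun q => ?_
  congr 1
  set e := (homologyEquiv q a).baseChange ℂ (RatFunc ℂ) _ _
  rw [← LinearMap.det_conj (LinearMap.id -
    (RatFunc.X : RatFunc ℂ) • (homologyAction q h).baseChange (RatFunc ℂ)) e]
  congr 1
  rw [homologyAction_conj q a hk, LinearMap.baseChange_comp, LinearMap.baseChange_comp]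
  ext y
  simp [e]

/-! ### Finite subsets of the projective line -/

/-- The plane minus a countable set is path connected, having real dimension greater than one. Its
image is dense in the projective line, so any set lying between this image and its closure, such as
`Aᶜ`, is connected. -/
theorem isPreconnected_compl_of_finite {A : Set (OnePoint ℂ)} (hA : A.Finite) :
    IsPreconnected Aᶜ := by
  have hB : (((↑) : ℂ → OnePoint ℂ) ⁻¹' A).Finite :=
    hA.preimage (OnePoint.coe_injective.injOn)
  have h1 : IsPreconnected (((↑) : ℂ → OnePoint ℂ) '' (((↑) : ℂ → OnePoint ℂ) ⁻¹' A)ᶜ) :=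
    (hB.countable.isPathConnected_compl_of_one_lt_rank
      (by rw [Complex.rank_real_complex]; norm_num)).isConnected.isPreconnected.image _
        OnePoint.continuous_coe.continuousOn
  refine h1.subset_closure ?_ fun c _ => ?_
  · rintro _ ⟨z, hz, rfl⟩
    exact hz
  · have h2 : Dense (((↑) : ℂ → OnePoint ℂ) ⁻¹' A)ᶜ := hB.countable.dense_compl ℝ
    exact OnePoint.denseRange_coe.dense_image OnePoint.continuous_coe h2 c

theorem eventually_nhdsGT_zero_ne (a : ℝ) : ∀ᶠ r : ℝ in 𝓝[>] 0, r ≠ a := by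
  rcases le_or_gt a 0 with ha | ha
  · filter_upwards [self_mem_nhdsWithin] with r hr
    exact (ha.trans_lt hr).ne'
  · filter_upwards [nhdsWithin_le_nhds (Iio_mem_nhds ha)] with r hr
    exact ne_of_lt hr

/-- Each point of `S` lies on the loop for at most one radius, and no loop passes through `∞`;
finitely many radii are avoided near `0`. -/
theorem eventually_simpleLoop_notMem (c : OnePoint ℂ) {S : Set (OnePoint ℂ)} (hS : S.Finite) :
    ∀ᶠ r : ℝ in 𝓝[>] 0, ∀ t, simpleLoop c r t ∉ S := by
  have key : ∀ s ∈ S, ∀ᶠ r : ℝ in 𝓝[>] 0, ∀ t, simpleLoop c r t ≠ s := by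
    intro s _
    induction s using OnePoint.rec with
    | infty =>
      refine Eventually.of_forall fun r t => ?_
      induction c using OnePoint.rec <;> exact OnePoint.coe_ne_infty _
    | coe w =>
      induction c using OnePoint.rec with
      | infty =>
        filter_upwards [eventually_nhdsGT_zero_ne ‖w‖⁻¹, self_mem_nhdsWithin] with r hr hr0 t ht
        have h : (circleMap 0 r (2 * Real.pi * t))⁻¹ = w := OnePoint.coe_injective ht
        exact hr (by rw [← h, norm_inv, inv_inv, norm_circleMap_zero, abs_of_pos hr0])
      | coe z =>
        filter_upwards [eventually_nhdsGT_zero_ne ‖w - z‖, self_mem_nhdsWithin] with r hr hr0 t ht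
        have h : circleMap z r (2 * Real.pi * t) = w := OnePoint.coe_injective ht
        exact hr (by rw [← h, circleMap_sub_center, norm_circleMap_zero, abs_of_pos hr0])
  filter_upwards [(eventually_all_finite hS).2 key] with r hr t ht
  exact hr _ ht t rfl

/-! ### Restriction of scalars -/

section RestrictScalars

variable {E F : Type*} [NormedAddCommGroup E] [NormedSpace ℂ E] [NormedSpace ℝ E]
  [IsScalarTower ℝ ℂ E] [NormedAddCommGroup F] [NormedSpace ℂ F] [NormedSpace ℝ F]
  [IsScalarTower ℝ ℂ F] {M N : Type*} [TopologicalSpace M] [ChartedSpace E M]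
  [TopologicalSpace N] [ChartedSpace F N] {k : ℕ∞ω}

/-- The charts are the same over both fields, so the claim reduces to restricting scalars for the
map read in charts. -/
theorem ContMDiff.restrictScalars_real {f : M → N} (h : ContMDiff 𝓘(ℂ, E) 𝓘(ℂ, F) k f) :
    ContMDiff 𝓘(ℝ, E) 𝓘(ℝ, F) k f := fun x => by
  have hx := contMDiffAt_iff.1 (h x)
  exact contMDiffAt_iff.2 ⟨hx.1, hx.2.restrict_scalars ℝ⟩

/-- A biholomorphism as a real diffeomorphism. -/
def Diffeomorph.restrictScalarsReal (d : Diffeomorph 𝓘(ℂ, E) 𝓘(ℂ, F) M N k) :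
    Diffeomorph 𝓘(ℝ, E) 𝓘(ℝ, F) M N k where
  toEquiv := d.toEquiv
  contMDiff_toFun := d.contMDiff.restrictScalars_real
  contMDiff_invFun := d.symm.contMDiff.restrictScalars_real

end RestrictScalars

/-! ### Diffeomorphisms of subsets -/

section Subset

variable {𝕜 : Type*} [NontriviallyNormedField 𝕜] {E H E' H' E'' H'' : Type*}
  [NormedAddCommGroup E] [NormedSpace 𝕜 E] [TopologicalSpace H]
  [NormedAddCommGroup E'] [NormedSpace 𝕜 E'] [TopologicalSpace H']
  [NormedAddCommGroup E''] [NormedSpace 𝕜 E''] [TopologicalSpace H'']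
  {I : ModelWithCorners 𝕜 E H} {J : ModelWithCorners 𝕜 E' H'} {K : ModelWithCorners 𝕜 E'' H''}
  {k : ℕ∞ω} {M N R : Type*} [TopologicalSpace M] [ChartedSpace H M] [TopologicalSpace N]
  [ChartedSpace H' N] [TopologicalSpace R] [ChartedSpace H'' R] {A : Set M} {B : Set N} {C : Set R}

theorem IsCkOnSubset.comp {g : A → B} {h : B → R} (hh : IsCkOnSubset J K k B h)
    (hg : IsCkOnSubset I J k A fun a => (g a : N)) : IsCkOnSubset I K k A (h ∘ g) := by
  intro a
  obtain ⟨W, G, hW, haW, hG, hGg⟩ := hg a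
  obtain ⟨W', G', hW', haW', hG', hGh⟩ := hh (g a)
  -- Compose the local extensions, on the part of `W` that `G` sends into the domain of `G'`.
  refine ⟨W ∩ G ⁻¹' W', G' ∘ G, hG.continuousOn.isOpen_inter_preimage hW hW', ⟨haW, ?_⟩,
    hG'.comp (hG.mono inter_subset_left) inter_subset_right, fun b hb => ?_⟩
  · rw [mem_preimage, hGg a haW]
    exact haW'
  · have h1 := hGg b hb.1
    have h2 : G b ∈ W' := hb.2
    rw [h1] at h2
    rw [Function.comp_apply, h1, hGh (g b) h2, Function.comp_apply]

/-- The inverse of a diffeomorphism of subsets. -/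
def SubsetDiffeo.symm (e : SubsetDiffeo I J k A B) : SubsetDiffeo J I k B A where
  toEquiv := e.toEquiv.symm
  isCk_toFun := e.isCk_invFun
  isCk_invFun := e.isCk_toFun

/-- The composition of diffeomorphisms of subsets. -/
def SubsetDiffeo.trans (e : SubsetDiffeo I J k A B) (e' : SubsetDiffeo J K k B C) :
    SubsetDiffeo I K k A C where
  toEquiv := e.toEquiv.trans e'.toEquiv
  isCk_toFun := e'.isCk_toFun.comp e.isCk_toFun
  isCk_invFun := e.isCk_invFun.comp e'.isCk_invFun

theorem isCkOnSubset_of_contMDiff {X : Opens M} (hA : A ⊆ X) {g : A → N} {G : X → N}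
    (hG : ContMDiff I J k G) (hGg : ∀ a : A, G ⟨a, hA a.2⟩ = g a) : IsCkOnSubset I J k A g := by
  intro a
  have hext : ∀ x : X, Function.extend Subtype.val G (fun _ => g a) (x : M) = G x :=
    fun x => Subtype.val_injective.extend_apply _ _ _
  -- The extension has to be a function on all of `M`; off the open set `X` its value is irrelevant,
  -- and `g a` is a point of `N` at hand.
  refine ⟨X, Function.extend Subtype.val G fun _ => g a, X.2, hA a.2, fun x hx => ?_,
    fun b _ => ?_⟩
  · refine ContMDiffAt.contMDiffWithinAt ((contMDiffAt_subtype_iff (x := (⟨x, hx⟩ : X))).1 ?_)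
    exact (hG ⟨x, hx⟩).congr_of_eventuallyEq (Eventually.of_forall hext)
  · rw [← hGg b]
    exact hext ⟨b, hA b.2⟩

end Subset

/-! ### Isomorphisms over an open set of values -/

theorem contMDiff_of_subtypeVal_comp {𝕜 : Type*} [NontriviallyNormedField 𝕜] {E H E' H' : Type*}
    [NormedAddCommGroup E] [NormedSpace 𝕜 E] [TopologicalSpace H]
    [NormedAddCommGroup E'] [NormedSpace 𝕜 E'] [TopologicalSpace H']
    {I : ModelWithCorners 𝕜 E H} {J : ModelWithCorners 𝕜 E' H'} {k : ℕ∞ω}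
    {M N : Type*} [TopologicalSpace M] [ChartedSpace H M] [TopologicalSpace N]
    [ChartedSpace H' N] {U : Opens N} {f : M → U}
    (h : ContMDiff I J k (Subtype.val ∘ f)) : ContMDiff I J k f := fun x =>
  (ChartedSpace.liftPropWithinAt_subtypeVal_comp_iff f univ x).1 (h x)

namespace MeroFun

section

variable {n : ℕ} {M : Type u} [TopologicalSpace M] [ChartedSpace (Cn n) M]
  {L : M → Type v} [∀ x, AddCommMonoid (L x)] [∀ x, Module ℂ (L x)]
  [∀ x, TopologicalSpace (L x)] [TopologicalSpace (TotalSpace ℂ L)] [FiberBundle ℂ L]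
  [VectorBundle ℂ ℂ L] {P Q : Cₛ^ω⟮𝓘(ℂ, Cn n); ℂ, L⟯} {W : Opens (OnePoint ℂ)}

theorem fibre_subset_preimage {c : OnePoint ℂ} (hc : c ∈ W) : fibre P Q c ⊆ preimage P Q W := by
  rintro x ⟨hx, rfl⟩
  exact ⟨hx, hc⟩

theorem preimage_mono {U : Opens (OnePoint ℂ)} (h : W ≤ U) : preimage P Q W ≤ preimage P Q U :=
  fun _ hx => ⟨hx.1, h hx.2⟩

theorem IsTrivialOver.mono {U : Opens (OnePoint ℂ)} (hU : IsTrivialOver P Q U) (h : W ≤ U) :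
    IsTrivialOver P Q W := by
  obtain ⟨F, _, _, hF, e, he⟩ := hU
  have hsymm : ∀ p, toProj P Q (e.symm p) = p.1 := fun p => by
    rw [← he, e.apply_symm_apply]
  -- Keep the factor `F`. The base coordinate is taken to be `toProj` itself, which lies in `W` by
  -- membership in the preimage and agrees with that of `e` by `he`.
  refine ⟨F, inferInstance, inferInstance, hF, ⟨⟨
    fun x => (⟨toProj P Q x, x.2.2⟩, (e (Opens.inclusion (preimage_mono h) x)).2),
    fun p => ⟨e.symm (Opens.inclusion h p.1, p.2),
      (e.symm (Opens.inclusion h p.1, p.2)).2.1, ?_⟩, fun x => ?_, fun p => ?_⟩, ?_, ?_⟩,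
    fun x => rfl⟩
  · rw [hsymm]
    exact p.1.2
  · apply Subtype.ext
    change (e.symm _ : M) = x
    have hx : (Opens.inclusion h ⟨toProj P Q x, x.2.2⟩,
        (e (Opens.inclusion (preimage_mono h) x)).2) = e (Opens.inclusion (preimage_mono h) x) :=
      Prod.ext (Subtype.ext (he (Opens.inclusion (preimage_mono h) x)).symm) rfl
    rw [hx, e.symm_apply_apply]
  · exact Prod.ext (Subtype.ext (hsymm _))
      (congrArg Prod.snd (e.apply_symm_apply (Opens.inclusion h p.1, p.2)) :)
  · have h1 := e.contMDiff.comp (contMDiff_inclusion (preimage_mono (P := P) (Q := Q) h))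
    refine ContMDiff.prodMk (contMDiff_of_subtypeVal_comp ?_) (contMDiff_snd.comp h1)
    exact (contMDiff_subtype_val.comp (contMDiff_fst.comp h1)).congr fun x =>
      (he (Opens.inclusion (preimage_mono h) x)).symm
  · refine contMDiff_of_subtypeVal_comp ?_
    exact (contMDiff_subtype_val.comp (e.symm.contMDiff.comp
      (((contMDiff_inclusion h).comp contMDiff_fst).prodMk contMDiff_snd)) :)

/-- Two fibres over a set of values on which the fibration is trivial are diffeomorphic. -/
theorem IsTrivialOver.nonempty_subsetDiffeo (hW : IsTrivialOver P Q W) {c c' : OnePoint ℂ}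
    (hc : c ∈ W) (hc' : c' ∈ W) : Nonempty (SubsetDiffeo 𝓘(ℝ, Cn n) 𝓘(ℝ, Cn n) ∞
      (fibre P Q c) (fibre P Q c')) := by
  obtain ⟨F, _, _, hF, e, he⟩ := hW
  have hsymm : ∀ p, toProj P Q (e.symm p) = p.1 := fun p => by
    rw [← he, e.apply_symm_apply]
  -- `G b` moves a point to the fibre over `b`, keeping its `F`-coordinate. It is smooth on the
  -- whole preimage of `W`, and so provides the extensions demanded of a smooth map between fibres.
  let G : W → preimage P Q W → M := fun b x => e.symm (b, (e x).2)
  have hG : ∀ b, ContMDiff 𝓘(ℝ, Cn n) 𝓘(ℝ, Cn n) ∞ (G b) := fun b =>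
    contMDiff_subtype_val.comp (e.symm.contMDiff.comp
      (contMDiff_const.prodMk (contMDiff_snd.comp e.contMDiff)))
  have hmem : ∀ (b : W) x, G b x ∈ fibre P Q b := fun b x => ⟨(e.symm (b, (e x).2)).2.1, hsymm _⟩
  have hinv : ∀ (b b' : W) (x : preimage P Q W) (hx : (x : M) ∈ fibre P Q b) hm,
      G b ⟨G b' x, hm⟩ = x := by
    intro b b' x hx hm
    change ((e.symm (b, (e (e.symm (b', (e x).2))).2) : preimage P Q W) : M) = x
    rw [e.apply_symm_apply]
    have : (b, (e x).2) = e x := Prod.ext (Subtype.ext ((he x).trans hx.2).symm) rfl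
    rw [this, e.symm_apply_apply]
  exact ⟨⟨⟨fun x => ⟨G ⟨c', hc'⟩ ⟨x, fibre_subset_preimage hc x.2⟩, hmem _ _⟩,
    fun x => ⟨G ⟨c, hc⟩ ⟨x, fibre_subset_preimage hc' x.2⟩, hmem _ _⟩,
    fun x => Subtype.ext (hinv ⟨c, hc⟩ _ ⟨x, fibre_subset_preimage hc x.2⟩ x.2 _),
    fun x => Subtype.ext (hinv ⟨c', hc'⟩ _ ⟨x, fibre_subset_preimage hc' x.2⟩ x.2 _)⟩,
    isCkOnSubset_of_contMDiff (fibre_subset_preimage hc) (hG _) fun _ => rfl,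
    isCkOnSubset_of_contMDiff (fibre_subset_preimage hc') (hG _) fun _ => rfl⟩⟩

/-- Any two fibres over the complement of a finite set over which the fibration is locally trivial
are diffeomorphic. -/
theorem IsLocallyTrivialOver.nonempty_subsetDiffeo {A : Set (OnePoint ℂ)} (hA : A.Finite)
    (h : IsLocallyTrivialOver P Q Aᶜ) {c c' : OnePoint ℂ} (hc : c ∉ A) (hc' : c' ∉ A) :
    Nonempty (SubsetDiffeo 𝓘(ℝ, Cn n) 𝓘(ℝ, Cn n) ∞ (fibre P Q c) (fibre P Q c')) := by
  -- Having diffeomorphic fibres is an equivalence relation, and by local triviality each value is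
  -- related to all nearby ones; on a connected set all values are then related.
  refine (isPreconnected_compl_of_finite hA).induction₂ (fun c c' => Nonempty
    (SubsetDiffeo 𝓘(ℝ, Cn n) 𝓘(ℝ, Cn n) ∞ (fibre P Q c) (fibre P Q c'))) ?_ ?_ ?_ hc hc'
  · intro b hb
    obtain ⟨U, hbU, hU⟩ := h b hb
    filter_upwards [nhdsWithin_le_nhds (U.2.mem_nhds hbU)] with b' hb'
    exact hU.nonempty_subsetDiffeo hbU hb'
  · rintro _ _ _ - - - ⟨e⟩ ⟨e'⟩
    exact ⟨e.trans e'⟩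
  · rintro _ _ - - ⟨e⟩
    exact ⟨e.symm⟩

variable {M' : Type u} [TopologicalSpace M'] [ChartedSpace (Cn n) M']
  {L' : M' → Type v} [∀ x, AddCommMonoid (L' x)] [∀ x, Module ℂ (L' x)]
  [∀ x, TopologicalSpace (L' x)] [TopologicalSpace (TotalSpace ℂ L')] [FiberBundle ℂ L']
  [VectorBundle ℂ ℂ L'] {P' Q' : Cₛ^ω⟮𝓘(ℂ, Cn n); ℂ, L'⟯}

/-- The restriction of an isomorphism over an open set of values to a smaller one. -/
def restrictPreimage {U : Opens (OnePoint ℂ)}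
    (d : Diffeomorph 𝓘(ℂ, Cn n) 𝓘(ℂ, Cn n) (preimage P' Q' U) (preimage P Q U) ω)
    (hd : ∀ x, toProj P Q (d x) = toProj P' Q' x) (h : W ≤ U) :
    Diffeomorph 𝓘(ℂ, Cn n) 𝓘(ℂ, Cn n) (preimage P' Q' W) (preimage P Q W) ω where
  toFun x := ⟨d (Opens.inclusion (preimage_mono h) x), (d _).2.1, by rw [hd]; exact x.2.2⟩
  invFun x := ⟨d.symm (Opens.inclusion (preimage_mono h) x), (d.symm _).2.1, by
    rw [← hd, d.apply_symm_apply]; exact x.2.2⟩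
  left_inv x := Subtype.ext (congrArg Subtype.val
    (d.symm_apply_apply (Opens.inclusion (preimage_mono h) x)) :)
  right_inv x := Subtype.ext (congrArg Subtype.val
    (d.apply_symm_apply (Opens.inclusion (preimage_mono h) x)) :)
  contMDiff_toFun := contMDiff_of_subtypeVal_comp (contMDiff_subtype_val.comp
    (d.contMDiff.comp (contMDiff_inclusion (preimage_mono h))) :)
  contMDiff_invFun := contMDiff_of_subtypeVal_comp (contMDiff_subtype_val.comp
    (d.symm.contMDiff.comp (contMDiff_inclusion (preimage_mono h))) :)

theorem IsTrivialOver.of_diffeomorph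
    (d : Diffeomorph 𝓘(ℂ, Cn n) 𝓘(ℂ, Cn n) (preimage P' Q' W) (preimage P Q W) ω)
    (hd : ∀ x, toProj P Q (d x) = toProj P' Q' x) (h : IsTrivialOver P Q W) :
    IsTrivialOver P' Q' W := by
  obtain ⟨F, _, _, hF, e, he⟩ := h
  exact ⟨F, _, _, hF, (Diffeomorph.mk d.toEquiv (d.restrictScalarsReal.contMDiff.of_le le_top)
    (d.restrictScalarsReal.symm.contMDiff.of_le le_top)).trans e, fun x => (he _).trans (hd x)⟩

/-- Replace the exceptional set `A` by `A ∪ S` and shrink each trivialising open set to its part in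
`W`, where `d` carries the trivialisation over. -/
theorem IsGenericValue.of_diffeomorph {S : Set (OnePoint ℂ)} (hS : S.Finite) (hW : (W : Set _) = Sᶜ)
    (d : Diffeomorph 𝓘(ℂ, Cn n) 𝓘(ℂ, Cn n) (preimage P' Q' W) (preimage P Q W) ω)
    (hd : ∀ x, toProj P Q (d x) = toProj P' Q' x) {c : OnePoint ℂ} (hc : c ∉ S)
    (h : IsGenericValue P Q c) : IsGenericValue P' Q' c := by
  obtain ⟨A, hA, hloc, hcA⟩ := h
  refine ⟨A ∪ S, hA.union hS, fun b hb => ?_, fun hcAS => hcAS.elim hcA hc⟩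
  obtain ⟨U, hbU, hU⟩ := hloc b fun h => hb (Or.inl h)
  have hbW : b ∈ (W : Set _) := hW ▸ fun h => hb (Or.inr h)
  exact ⟨U ⊓ W, ⟨hbU, hbW⟩, (hU.mono inf_le_left).of_diffeomorph
    (restrictPreimage d hd inf_le_right) fun x =>
      (hd (Opens.inclusion (preimage_mono inf_le_right) x) :)⟩

variable (d : Diffeomorph 𝓘(ℂ, Cn n) 𝓘(ℂ, Cn n) (preimage P' Q' W) (preimage P Q W) ω)
  (hd : ∀ x, toProj P Q (d x) = toProj P' Q' x)

/-- The bijection of fibres induced by an isomorphism over an open set of values. -/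
def fibreEquiv {c : OnePoint ℂ} (hc : c ∈ W) : fibre P' Q' c ≃ fibre P Q c where
  toFun x := ⟨d ⟨x, fibre_subset_preimage hc x.2⟩, (d _).2.1, (hd _).trans x.2.2⟩
  invFun x := ⟨d.symm ⟨x, fibre_subset_preimage hc x.2⟩, (d.symm _).2.1, by
    rw [← hd, d.apply_symm_apply]; exact x.2.2⟩
  left_inv x := Subtype.ext (congrArg Subtype.val
    (d.symm_apply_apply ⟨x, fibre_subset_preimage hc x.2⟩) :)
  right_inv x := Subtype.ext (congrArg Subtype.val
    (d.apply_symm_apply ⟨x, fibre_subset_preimage hc x.2⟩) :)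

/-- The biholomorphism of fibres induced by an isomorphism over an open set of values. -/
def fibreDiffeo {c : OnePoint ℂ} (hc : c ∈ W) :
    SubsetDiffeo 𝓘(ℂ, Cn n) 𝓘(ℂ, Cn n) ω (fibre P' Q' c) (fibre P Q c) where
  toEquiv := fibreEquiv d hd hc
  isCk_toFun := isCkOnSubset_of_contMDiff (fibre_subset_preimage hc)
    (contMDiff_subtype_val.comp d.contMDiff) fun _ => rfl
  isCk_invFun := isCkOnSubset_of_contMDiff (fibre_subset_preimage hc)
    (contMDiff_subtype_val.comp d.symm.contMDiff) fun _ => rfl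

/-- The real diffeomorphism of fibres induced by an isomorphism over an open set of values. -/
def fibreRealDiffeo {c : OnePoint ℂ} (hc : c ∈ W) :
    SubsetDiffeo 𝓘(ℝ, Cn n) 𝓘(ℝ, Cn n) ∞ (fibre P' Q' c) (fibre P Q c) where
  toEquiv := fibreEquiv d hd hc
  isCk_toFun := isCkOnSubset_of_contMDiff (fibre_subset_preimage hc)
    (contMDiff_subtype_val.comp (d.restrictScalarsReal.contMDiff.of_le le_top)) fun _ => rfl
  isCk_invFun := isCkOnSubset_of_contMDiff (fibre_subset_preimage hc)
    (contMDiff_subtype_val.comp (d.restrictScalarsReal.symm.contMDiff.of_le le_top)) fun _ => rfl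

/-- The homeomorphism of fibres induced by an isomorphism over an open set of values. -/
def fibreHomeo {c : OnePoint ℂ} (hc : c ∈ W) : fibre P' Q' c ≃ₜ fibre P Q c where
  toEquiv := fibreEquiv d hd hc
  continuous_toFun := Continuous.subtype_mk (continuous_subtype_val.comp
    (d.continuous.comp (Continuous.subtype_mk continuous_subtype_val _))) _
  continuous_invFun := Continuous.subtype_mk (continuous_subtype_val.comp
    (d.symm.continuous.comp (Continuous.subtype_mk continuous_subtype_val _))) _

/-- A family `Γ_t` over a loop inside `W` is carried to `d ∘ Γ_t ∘ a⁻¹`, where `a` is `d` on the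
initial fibre; its end map is the conjugate of `h` by `a`. -/
theorem IsMonodromy.map {γ : unitInterval → OnePoint ℂ} (hγ : ∀ t, γ t ∈ W)
    {h : C(fibre P' Q' (γ 0), fibre P' Q' (γ 0))} (hh : IsMonodromy P' Q' γ h) :
    IsMonodromy P Q γ ((fibreHomeo d hd (hγ 0) : C(_, _)).comp
      (h.comp ((fibreHomeo d hd (hγ 0)).symm : C(_, _)))) := by
  obtain ⟨Γ, hΓ, hmem, h0, h1⟩ := hh
  have hΓW : ∀ p : unitInterval × fibre P' Q' (γ 0), Γ p ∈ preimage P' Q' W :=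
    fun p => fibre_subset_preimage (hγ p.1) (hmem p.1 p.2)
  set a := fibreHomeo d hd (hγ 0)
  refine ⟨fun p => d ⟨Γ (p.1, a.symm p.2), hΓW _⟩, ?_, fun t x => ⟨(d _).2.1, ?_⟩, fun x => ?_,
    fun x => ?_⟩
  · refine continuous_subtype_val.comp (d.continuous.comp (Continuous.subtype_mk (hΓ.comp ?_) _))
    exact continuous_fst.prodMk (a.symm.continuous.comp continuous_snd)
  · exact (hd _).trans (hmem t (a.symm x)).2
  · have : ∀ y : fibre P' Q' (γ 0), ∀ hy, (d ⟨y, hy⟩ : M) = a y := fun _ _ => rfl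
    simp only [h0]
    rw [this, a.apply_symm_apply]
  · simp only [h1]
    rfl

/-- Small loops avoid `S`, so monodromy can be transported in both directions: `d.symm` supplies a
transformation for the second function, while `d` sends an arbitrary one back to where the
zeta-function is known. -/
theorem HasLocalZeta.of_diffeomorph
    (d : Diffeomorph 𝓘(ℂ, Cn n) 𝓘(ℂ, Cn n) (preimage P' Q' W) (preimage P Q W) ω)
    (hd : ∀ x, toProj P Q (d x) = toProj P' Q' x)
    {S : Set (OnePoint ℂ)} (hS : S.Finite) (hW : (W : Set _) = Sᶜ)
    {c : OnePoint ℂ} {ζ : RatFunc ℂ} (h : HasLocalZeta P Q c ζ) : HasLocalZeta P' Q' c ζ := by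
  have hd' : ∀ x, toProj P' Q' (d.symm x) = toProj P Q x := fun x => by
    rw [← hd, d.apply_symm_apply]
  filter_upwards [h, eventually_simpleLoop_notMem c hS] with r ⟨hgen, hfin, ⟨g, hg⟩, hζ⟩ hr
  have hγ : ∀ t, simpleLoop c r t ∈ W := fun t => by
    rw [← SetLike.mem_coe, hW]
    exact hr t
  refine ⟨fun t => (hgen t).of_diffeomorph hS hW d hd (hr t),
    hfin.of_homeomorph (fibreHomeo d hd (hγ 0)).symm, ⟨_, hg.map d.symm hd' hγ⟩, fun g' hg' => ?_⟩
  rw [← hζ _ (hg'.map d hd hγ)]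
  refine (zetaFunction_conj (fibreHomeo d hd (hγ 0)) fun x => ?_).symm
  simp

end

/-! ### Modifications -/

section

variable {n : ℕ} {M : Type u} [TopologicalSpace M] [ChartedSpace (Cn n) M]
  {M' : Type u} [TopologicalSpace M'] [ChartedSpace (Cn n) M']
  {L : M → Type v} [∀ x, AddCommMonoid (L x)] [∀ x, Module ℂ (L x)]
  [∀ x, TopologicalSpace (L x)] [TopologicalSpace (TotalSpace ℂ L)] [FiberBundle ℂ L]
  [VectorBundle ℂ ℂ L]

/-- A modification which is an isomorphism over `f⁻¹(W)` as an isomorphism over `W`. -/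
theorem IsIsoOver.exists_diffeomorph {P Q : Cₛ^ω⟮𝓘(ℂ, Cn n); ℂ, L⟯} {W : Opens (OnePoint ℂ)}
    {φ : C^ω⟮𝓘(ℂ, Cn n), M'; 𝓘(ℂ, Cn n), M⟯} (hφ : IsIsoOver φ (preimage P Q W)) :
    ∃ d : Diffeomorph 𝓘(ℂ, Cn n) 𝓘(ℂ, Cn n)
      (preimage (liftSection φ P) (liftSection φ Q) W) (preimage P Q W) ω,
      ∀ x, (d x : M) = φ x := by
  let g : preimage (liftSection φ P) (liftSection φ Q) W → preimage P Q W := fun x => ⟨φ x, x.2⟩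
  have hg : Function.Bijective g := by
    refine ⟨fun x y hxy => Subtype.ext (hφ.1.injOn x.2 y.2 (congrArg Subtype.val hxy)), fun y => ?_⟩
    obtain ⟨x, hx, hxy⟩ := hφ.1.surjOn y.2
    exact ⟨⟨x, hx⟩, Subtype.ext hxy⟩
  refine ⟨⟨Equiv.ofBijective g hg, ?_, contMDiff_of_subtypeVal_comp fun y => ?_⟩,
    fun x => rfl⟩
  · exact contMDiff_of_subtypeVal_comp (φ.contMDiff.comp contMDiff_subtype_val)
  · obtain ⟨x, rfl⟩ := hg.2 y
    -- Near `g x` the global inverse coincides with the holomorphic local inverse `Φ.symm`: both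
    -- values are points of the preimage lying over the same `z`, and `φ` is injective there.
    obtain ⟨Φ, hxΦ, hΦ⟩ := hφ.2 ⟨x, x.2⟩
    have hy : ((g x : preimage P Q W) : M) ∈ Φ.target := by
      change φ x ∈ Φ.target
      rw [hΦ hxΦ]
      exact Φ.map_source hxΦ
    have hopen := Φ.open_target.mem_nhds hy
    have hsm : ContMDiffAt 𝓘(ℂ, Cn n) 𝓘(ℂ, Cn n) ω
        (fun z : preimage P Q W => Φ.symm (z : M)) (g x) :=
      contMDiffAt_subtype_iff.2 (Φ.symm.contMDiffOn.contMDiffAt hopen)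
    refine hsm.congr_of_eventuallyEq ?_
    filter_upwards [continuous_subtype_val.continuousAt.preimage_mem_nhds hopen] with z hz
    have h1 : Φ.symm (z : M) ∈ Φ.source := Φ.map_target hz
    have h2 : φ (Φ.symm (z : M)) = z := (hΦ h1).trans (Φ.right_inv hz)
    have h3 : Φ.symm (z : M) ∈ φ ⁻¹' (preimage P Q W : Set M) := by
      rw [mem_preimage, h2]
      exact z.2
    obtain ⟨w, rfl⟩ := hg.2 z
    have h4 : (Equiv.ofBijective g hg).symm (g w) = w := (Equiv.ofBijective g hg).symm_apply_apply w
    rw [Function.comp_apply, h4]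
    exact hφ.1.injOn w.2 h3 h2.symm

end

end MeroFun

end

theorem mainTheorem6 {n : ℕ}
    {M : Type u} [TopologicalSpace M] [T2Space M] [CompactSpace M] [ChartedSpace (Cn n) M]
    [IsManifold 𝓘(ℂ, Cn n) ω M]
    {M' : Type u} [TopologicalSpace M'] [T2Space M'] [CompactSpace M'] [ChartedSpace (Cn n) M']
    [IsManifold 𝓘(ℂ, Cn n) ω M']
    {L : M → Type v} [∀ x, AddCommGroup (L x)] [∀ x, Module ℂ (L x)]
    [∀ x, TopologicalSpace (L x)] [TopologicalSpace (TotalSpace ℂ L)] [FiberBundle ℂ L]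
    [VectorBundle ℂ ℂ L] [ContMDiffVectorBundle ω ℂ L 𝓘(ℂ, Cn n)]
    (P Q : Cₛ^ω⟮𝓘(ℂ, Cn n); ℂ, L⟯) (hP : P ≠ 0) (hQ : Q ≠ 0)
    (φ : C^ω⟮𝓘(ℂ, Cn n), M'; 𝓘(ℂ, Cn n), M⟯)
    (S : Set (OnePoint ℂ)) (hS : S.Finite)
    (hφ : MeroFun.IsIsoOver φ (MeroFun.indeterminacy P Q ∪ ⋃ c ∈ S, MeroFun.fibre P Q c)ᶜ)
    (P' Q' : Cₛ^ω⟮𝓘(ℂ, Cn n); ℂ, (φ : M' → M) *ᵖ L⟯)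
    (hP' : P' = MeroFun.liftSection φ P) (hQ' : Q' = MeroFun.liftSection φ Q) :
    -- outside of `S`, the generic values of `P' / Q'` and `P / Q` agree, and `φ` identifies fibres
    (∀ c, c ∉ S → (MeroFun.IsGenericValue P' Q' c ↔ MeroFun.IsGenericValue P Q c) ∧
      ∃ e : SubsetDiffeo 𝓘(ℂ, Cn n) 𝓘(ℂ, Cn n) ω
          (MeroFun.fibre P' Q' c) (MeroFun.fibre P Q c),
        ∀ x, ((e.toEquiv x : MeroFun.fibre P Q c) : M) = φ x) ∧
    -- any two generic fibres are diffeomorphic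
    (∀ c' c, MeroFun.IsGenericValue P' Q' c' → MeroFun.IsGenericValue P Q c →
      Nonempty (SubsetDiffeo 𝓘(ℝ, Cn n) 𝓘(ℝ, Cn n) ∞
        (MeroFun.fibre P' Q' c') (MeroFun.fibre P Q c))) ∧
    -- the zeta-functions of the local monodromies agree at every value
    ∀ c : OnePoint ℂ,
      (∀ ζ, MeroFun.HasLocalZeta P' Q' c ζ ↔ MeroFun.HasLocalZeta P Q c ζ) ∧
      MeroFun.localZeta P' Q' c = MeroFun.localZeta P Q c := by
  subst hP' hQ'
  let W : Opens (OnePoint ℂ) := ⟨Sᶜ, hS.isClosed.isOpen_compl⟩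
  have hW : (W : Set (OnePoint ℂ)) = Sᶜ := rfl
  -- A determinate point lies in no fibre over `S` exactly when its value is in `W`.
  have hpre : (MeroFun.indeterminacy P Q ∪ ⋃ c ∈ S, MeroFun.fibre P Q c)ᶜ =
      (MeroFun.preimage P Q W : Set M) := by
    ext x
    simp only [mem_compl_iff, mem_union, mem_iUnion, not_or, not_exists]
    exact ⟨fun h => ⟨h.1, fun hx => h.2 _ hx ⟨h.1, rfl⟩⟩,
      fun h => ⟨h.1, fun c hc hx => h.2 (hx.2 ▸ hc)⟩⟩
  rw [hpre] at hφ
  obtain ⟨d, hdφ⟩ := hφ.exists_diffeomorph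
  have hd : ∀ x, MeroFun.toProj P Q (d x) =
      MeroFun.toProj (MeroFun.liftSection φ P) (MeroFun.liftSection φ Q) x := fun x => by
    rw [hdφ]
    rfl
  have hd' : ∀ x, MeroFun.toProj (MeroFun.liftSection φ P) (MeroFun.liftSection φ Q) (d.symm x) =
      MeroFun.toProj P Q x := fun x => by
    rw [← hd, d.apply_symm_apply]
  have hζ : ∀ c ζ, MeroFun.HasLocalZeta (MeroFun.liftSection φ P) (MeroFun.liftSection φ Q) c ζ ↔
      MeroFun.HasLocalZeta P Q c ζ := fun c ζ =>
    ⟨fun h => h.of_diffeomorph d.symm hd' hS hW, fun h => h.of_diffeomorph d hd hS hW⟩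
  refine ⟨fun c hc => ⟨⟨fun h => h.of_diffeomorph hS hW d.symm hd' hc,
    fun h => h.of_diffeomorph hS hW d hd hc⟩, MeroFun.fibreDiffeo d hd hc, fun x => hdφ _⟩,
    ?_, fun c => ⟨hζ c, ?_⟩⟩
  · rintro c' c ⟨A', hA', hloc', hc'⟩ ⟨A, hA, hloc, hc⟩
    -- An intermediate value is needed since `c'` or `c` may lie in `S`. At `b` both fibrations are
    -- locally trivial and `d` identifies the two fibres; finite sets have infinite complement, so
    -- `b` exists.
    obtain ⟨b, hb⟩ := ((hA'.union hA).union hS).infinite_compl.nonempty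
    simp only [mem_compl_iff, mem_union, not_or] at hb
    obtain ⟨e'⟩ := hloc'.nonempty_subsetDiffeo hA' hc' hb.1.1
    obtain ⟨e⟩ := hloc.nonempty_subsetDiffeo hA hb.1.2 hc
    exact ⟨(e'.trans (MeroFun.fibreRealDiffeo d hd hb.2)).trans e⟩
  -- The two predicates on `ζ` are equal, hence so are the chosen values, including the default `0`
  -- when no `ζ` exists.
  · have h := funext fun ζ => propext (hζ c ζ)
    unfold MeroFun.localZeta
    rw [h]
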